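/- Let $\triangle=\{(x,y)\in\mathbb{R}^2: 1>x>y>0\}$ and, for every integer $k\ge 0$, let $$\triangle_k=\{(x,y)\in\triangle : 1-x-ky\ge 0>1-x-(k+1)y\}.$$ The sets $\triangle_k$ partition $\triangle$. The triangle map $T$ is defined on $\triangle$ by $$T(x,y)=\left(\frac{y}{x},\frac{1-x-ky}{x}\right)\quad\text{for }(x,y)\in\triangle_k.$$ A point $(x,y)\in\triangle$ has triangle sequence $(a_0,a_1,a_2,\dots)$ if $T^N(x,y)\in\triangle_{a_N}$ for every $N\ge 0$; this sequence is unique when it exists. (It fails to exist exactly when the orbit leaves $\triangle$.) Let $\mu$ be the measure on $\triangle$ given by $$d\mu=\frac{12}{\pi^2x(1+y)}\,dx\,dy .$$ Then $\mu$ is a probability measure invariant under $T$. Moreover, Lebesgue-almost every $(\alpha,\beta)\in\triangle$ has an infinite triangle sequence $(a_0,a_1,a_2,\dots)$, and for every integer $k\ge 0$ the limit $$P_k(\alpha,\beta)=\lim_{n\to\infty}\frac{\#\{i : 0\le i<n,\ a_i=k\}}{n}$$ exists and $$P_k(\alpha,\beta)=\int_{\triangle_k}d\mu=\int_{\triangle_k}\frac{12}{\pi^2x(1+y)}\,dx\,dy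 .$$ -/

import Mathlib

open MeasureTheory Filter Topology

namespace TriangleMap

/-- The open triangle `△ = {(x, y) : 1 > x > y > 0}`. -/
def triangle : Set (ℝ × ℝ) := {p | 1 > p.1 ∧ p.1 > p.2 ∧ p.2 > 0}

/-- The subtriangle `△_k = {(x, y) ∈ △ : 1 - x - k y ≥ 0 > 1 - x - (k + 1) y}`. -/
def subtriangle (k : ℕ) : Set (ℝ × ℝ) :=
  {p | p ∈ triangle ∧ 1 - p.1 - k * p.2 ≥ 0 ∧ 0 > 1 - p.1 - (k + 1) * p.2}

/-- The branch `T_k (x, y) = (y / x, (1 - x - k y) / x)`. -/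
noncomputable def branch (k : ℕ) (p : ℝ × ℝ) : ℝ × ℝ :=
  (p.2 / p.1, (1 - p.1 - k * p.2) / p.1)

/-- For `p ∈ △`, the unique `k` with `p ∈ △_k` (see `mem_subtriangle_iff`). -/
noncomputable def index (p : ℝ × ℝ) : ℕ := ⌊(1 - p.1) / p.2⌋₊

/-- The triangle map: `T = T_k` on `△_k` (see `map_of_mem`). The values outside `△` play no role. -/
noncomputable def map (p : ℝ × ℝ) : ℝ × ℝ := branch (index p) p

theorem mem_subtriangle_iff {p : ℝ × ℝ} {k : ℕ} :
    p ∈ subtriangle k ↔ p ∈ triangle ∧ index p = k := by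
  refine and_congr_right fun hp => ?_
  obtain ⟨h1, _, h3⟩ := hp
  have h0 : 0 ≤ (1 - p.1) / p.2 := div_nonneg (by linarith) h3.le
  rw [index, Nat.floor_eq_iff h0, le_div_iff₀ h3, div_lt_iff₀ h3]
  constructor
  · rintro ⟨ha, hb⟩
    exact ⟨by linarith, by linarith⟩
  · rintro ⟨ha, hb⟩
    exact ⟨by linarith, by linarith⟩

theorem map_of_mem {p : ℝ × ℝ} {k : ℕ} (hp : p ∈ subtriangle k) : map p = branch k p := by
  rw [map, (mem_subtriangle_iff.1 hp).2]

/-- `(a_0, a_1, a_2, …)` is the triangle sequence of `p` : `T^N p ∈ △_{a_N}` for every `N`. -/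
def HasTriangleSequence (p : ℝ × ℝ) (a : ℕ → ℕ) : Prop :=
  ∀ N : ℕ, map^[N] p ∈ subtriangle (a N)

theorem HasTriangleSequence.unique {p : ℝ × ℝ} {a b : ℕ → ℕ}
    (ha : HasTriangleSequence p a) (hb : HasTriangleSequence p b) : a = b :=
  funext fun N => (mem_subtriangle_iff.1 (ha N)).2.symm.trans (mem_subtriangle_iff.1 (hb N)).2

/-- The proportion of the first `n` terms of the sequence `a` that are equal to `k`. -/
noncomputable def proportion (a : ℕ → ℕ) (k n : ℕ) : ℝ :=
  (((Finset.range n).filter fun i => a i = k).card : ℝ) / n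

/-- The density `12 / (π² x (1 + y))`. -/
noncomputable def density (p : ℝ × ℝ) : ℝ := 12 / (Real.pi ^ 2 * p.1 * (1 + p.2))

/-- The measure `dμ = 12 / (π² x (1 + y)) dx dy` on `△`. -/
noncomputable def invMeasure : Measure (ℝ × ℝ) :=
  (volume.restrict triangle).withDensity fun p => ENNReal.ofReal (density p)

end TriangleMap

/-! Each branch of `map` on `subtriangle k` is inverted by `invBranch k`, which maps the triangle
onto it up to a null edge, with Jacobian `(1 + kx + y)⁻³`. Invariance of the density is thus an
identity for a sum over `k`, and that sum telescopes (`hasSum_density_invBranch`). Expanding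
`1/(1+y)` in powers of `y²` reduces the total mass to `ζ(2)`.

The frequencies come from Birkhoff's theorem, applied to the shift on digit sequences with the
pushforward of the invariant measure. Working there requires zero-one laws only for sets determined
by digits, so whether digits determine the point never matters.

Ergodicity rests on bounded distortion. Transfer operators preserve the family of densities `(a + bx
+ cy)⁻³`. On a cylinder ending in the digit 0 both `b` and `c` are at most `a`, so the density
varies by a factor of at most 27 (`measure_cylinder_mul_le`). Almost every sequence has infinitely
many zeros, so these cylinders suffice to approximate measurable sets
(`measure_eq_zero_or_compl_of_cylinder`). -/

section Birkhoff

/-! ### Birkhoff's pointwise ergodic theorem -/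

variable {α : Type*} {f : α → α} {g : α → ℝ}

/-- The running maximum `max_{0 ≤ k ≤ n}` of the Birkhoff sums of `g` along `f`. -/
noncomputable def birkhoffMax (f : α → α) (g : α → ℝ) : ℕ → α → ℝ
  | 0, _ => 0
  | n + 1, x => max 0 (g x + birkhoffMax f g n (f x))

theorem birkhoffMax_nonneg (n : ℕ) (x : α) : 0 ≤ birkhoffMax f g n x := by
  cases n with
  | zero => exact le_rfl
  | succ n => exact le_max_left _ _

theorem birkhoffMax_le_succ (n : ℕ) (x : α) : birkhoffMax f g n x ≤ birkhoffMax f g (n + 1) x := by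
  induction n generalizing x with
  | zero => exact le_max_left _ _
  | succ n ih => exact max_le_max le_rfl (add_le_add le_rfl (ih _))

theorem birkhoffSum_le_birkhoffMax (n : ℕ) (x : α) : birkhoffSum f g n x ≤ birkhoffMax f g n x := by
  induction n generalizing x with
  | zero => simp [birkhoffMax]
  | succ n ih =>
    rw [birkhoffSum_succ']
    exact le_max_of_le_right (add_le_add le_rfl (ih _))

/-- Shows that the difference is dominated by `|g|` and equals `g x` once the maximum at `f x`
reaches `-g x`: the two inputs for dominated convergence. -/
theorem birkhoffMax_succ_sub (n : ℕ) (x : α) :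
    birkhoffMax f g (n + 1) x - birkhoffMax f g n (f x) =
      max (-birkhoffMax f g n (f x)) (g x) := by
  rw [birkhoffMax, ← max_sub_sub_right]
  simp

variable [MeasurableSpace α] {μ : Measure α}

theorem MeasureTheory.MeasurePreserving.integrable_birkhoffMax (hf : MeasurePreserving f μ μ)
    (hg : Integrable g μ) (n : ℕ) : Integrable (birkhoffMax f g n) μ := by
  induction n with
  | zero => exact integrable_zero _ _ _
  | succ n ih =>
    exact (integrable_zero _ _ _).sup (hg.add (hf.integrable_comp_of_integrable ih))

/-- If the integral of `g` is negative, its Birkhoff sums along an ergodic map are almost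
everywhere bounded above. -/
theorem Ergodic.ae_bddAbove_birkhoffSum (hf : Ergodic f μ) (hgm : Measurable g)
    (hg : Integrable g μ) (hneg : ∫ x, g x ∂μ < 0) :
    ∀ᵐ x ∂μ, ∃ C : ℕ, ∀ n, birkhoffSum f g n x ≤ C := by
  have hmp := hf.toMeasurePreserving
  set A : Set α := {x | ∃ C : ℕ, ∀ n, birkhoffSum f g n x ≤ C} with hA
  have hSm : ∀ n, Measurable (birkhoffSum f g n) := fun n =>
    Finset.measurable_fun_sum _ fun i _ => hgm.comp (hmp.measurable.iterate i)
  have hAm : MeasurableSet A := by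
    have : A = ⋃ C : ℕ, ⋂ n, {x | birkhoffSum f g n x ≤ C} := by ext; simp [hA]
    rw [this]
    exact .iUnion fun C => .iInter fun n => measurableSet_le (hSm n) measurable_const
  -- The Birkhoff sums at `x` and at `f x` differ by `g x` and an index shift, so they are bounded
  -- above together.
  have hinv : f ⁻¹' A = A := by
    ext x
    constructor
    · rintro ⟨C, hC⟩
      obtain ⟨K, hK⟩ := exists_nat_ge (|g x| + C)
      refine ⟨K, fun n => ?_⟩
      cases n with
      | zero => simp
      | succ n =>
        rw [birkhoffSum_succ']
        have := hC n
        have := le_abs_self (g x)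
        linarith
    · rintro ⟨C, hC⟩
      obtain ⟨K, hK⟩ := exists_nat_ge (|g x| + C)
      refine ⟨K, fun n => ?_⟩
      have := hC (n + 1)
      rw [birkhoffSum_succ'] at this
      have := neg_abs_le (g x)
      linarith
  -- If the sums are almost everywhere unbounded, the differences `M_{n+1} - M_n ∘ f` converge to
  -- `g`. Their integrals are nonnegative, by invariance and monotonicity in `n`, which contradicts
  -- `hneg`.
  refine (hf.ae_mem_or_ae_notMem hAm hinv).resolve_right fun hnot => ?_
  have hM := hmp.integrable_birkhoffMax hg
  have hMf : ∀ n, Integrable (fun x => birkhoffMax f g n (f x)) μ := fun n =>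
    hmp.integrable_comp_of_integrable (hM n)
  have hlim : Tendsto (fun n => ∫ x, (birkhoffMax f g (n + 1) x - birkhoffMax f g n (f x)) ∂μ)
      atTop (𝓝 (∫ x, g x ∂μ)) := by
    refine tendsto_integral_of_dominated_convergence (fun x => |g x|)
      (fun n => ((hM (n + 1)).sub (hMf n)).aestronglyMeasurable) hg.abs
      (fun n => ae_of_all _ fun x => ?_) ?_
    · rw [birkhoffMax_succ_sub, Real.norm_eq_abs]
      have h0 := birkhoffMax_nonneg (f := f) (g := g) n (f x)
      rcases le_total (-birkhoffMax f g n (f x)) (g x) with h | h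
      · rw [max_eq_right h]
      · rw [max_eq_left h, abs_of_nonpos (by linarith), abs_of_nonpos (by linarith)]
        linarith
    · filter_upwards [hnot] with x hx
      have hfx : f x ∉ A := fun h => hx (hinv ▸ h)
      obtain ⟨K, hK⟩ := exists_nat_ge (-g x)
      have : ∃ n, (K : ℝ) < birkhoffSum f g n (f x) := by
        by_contra! h
        exact hfx ⟨K, h⟩
      obtain ⟨N, hN⟩ := this
      refine tendsto_const_nhds.congr' ?_
      filter_upwards [eventually_ge_atTop N] with n hn
      rw [birkhoffMax_succ_sub, max_eq_right]
      have h1 := birkhoffSum_le_birkhoffMax (f := f) (g := g) N (f x)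
      have h2 := monotone_nat_of_le_succ
        (f := fun n => birkhoffMax f g n (f x)) (fun n => birkhoffMax_le_succ n (f x)) hn
      simp only at h2
      linarith
  refine hneg.not_ge (ge_of_tendsto' hlim fun n => ?_)
  have hcomp : ∫ x, birkhoffMax f g n (f x) ∂μ = ∫ x, birkhoffMax f g n x ∂μ := by
    have := integral_map (μ := μ) hmp.measurable.aemeasurable (f := birkhoffMax f g n)
      (by rw [hmp.map_eq]; exact (hM n).aestronglyMeasurable)
    rw [← this, hmp.map_eq]
  rw [integral_sub (hM _) (hMf n), hcomp, sub_nonneg]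
  exact integral_mono (hM n) (hM _) fun x => birkhoffMax_le_succ n x

/-- For `b` strictly between the integral and `c`, the sums of `g - b` are bounded by some `C`, so
the averages are at most `b + C/n`. -/
theorem Ergodic.ae_eventually_birkhoffAverage_lt [IsProbabilityMeasure μ] (hf : Ergodic f μ)
    (hgm : Measurable g) (hg : Integrable g μ) {c : ℝ} (hc : ∫ x, g x ∂μ < c) :
    ∀ᵐ x ∂μ, ∀ᶠ n in atTop, birkhoffAverage ℝ f g n x < c := by
  obtain ⟨b, hb, hbc⟩ := exists_between hc
  have h := hf.ae_bddAbove_birkhoffSum (g := fun x => g x - b) (hgm.sub_const b)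
    (hg.sub (integrable_const b)) (by
      rw [integral_sub hg (integrable_const b)]
      simpa using hb)
  filter_upwards [h] with x ⟨C, hC⟩
  have hlim : Tendsto (fun n : ℕ => b + (C : ℝ) / n) atTop (𝓝 (b + 0)) :=
    tendsto_const_nhds.add (tendsto_const_div_atTop_nhds_zero_nat _)
  filter_upwards [hlim.eventually (gt_mem_nhds (by simpa using hbc)), eventually_gt_atTop 0]
    with n hn h0
  have h0' : (0 : ℝ) < n := by exact_mod_cast h0
  refine lt_of_le_of_lt ?_ hn
  have h1 : birkhoffSum f g n x - n * b ≤ C := by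
    simpa [birkhoffSum, Finset.sum_sub_distrib] using hC n
  rw [birkhoffAverage, smul_eq_mul, inv_mul_le_iff₀ h0']
  have : (n : ℝ) * (b + C / n) = n * b + C := by field_simp
  linarith

/-- Birkhoff's pointwise ergodic theorem for an ergodic map of a probability space. -/
theorem Ergodic.ae_tendsto_birkhoffAverage [IsProbabilityMeasure μ] (hf : Ergodic f μ)
    (hgm : Measurable g) (hg : Integrable g μ) :
    ∀ᵐ x ∂μ, Tendsto (fun n => birkhoffAverage ℝ f g n x) atTop (𝓝 (∫ x, g x ∂μ)) := by
  have hpos (m : ℕ) : (0 : ℝ) < 1 / (m + 1) := Nat.one_div_pos_of_nat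
  have h1 : ∀ᵐ x ∂μ, ∀ m : ℕ, ∀ᶠ n in atTop,
      birkhoffAverage ℝ f g n x < (∫ x, g x ∂μ) + 1 / (m + 1) :=
    ae_all_iff.2 fun m => hf.ae_eventually_birkhoffAverage_lt hgm hg (by linarith [hpos m])
  have h2 : ∀ᵐ x ∂μ, ∀ m : ℕ, ∀ᶠ n in atTop,
      birkhoffAverage ℝ f (-g) n x < -(∫ x, g x ∂μ) + 1 / (m + 1) :=
    ae_all_iff.2 fun m => hf.ae_eventually_birkhoffAverage_lt hgm.neg hg.neg (by
      simp only [Pi.neg_apply, integral_neg]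
      linarith [hpos m])
  filter_upwards [h1, h2] with x hx1 hx2
  rw [Metric.tendsto_nhds]
  intro ε hε
  obtain ⟨m, hm⟩ := exists_nat_one_div_lt hε
  filter_upwards [hx1 m, hx2 m] with n hn1 hn2
  rw [birkhoffAverage_neg, Pi.neg_apply, Pi.neg_apply] at hn2
  rw [Real.dist_eq, abs_lt]
  constructor <;> linarith

end Birkhoff

/-! ### A zero-one criterion on sequence space -/

section Symbolic

open PiNat Set
open scoped ENNReal

/-- An open set of sequences is, up to sequences with finitely many zeros, a disjoint union of
cylinders whose last digit is zero. -/
theorem exists_disjoint_cylinders_of_isOpen {U : Set (ℕ → ℕ)} (hU : IsOpen U) :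
    ∃ 𝒞 : Set (Set (ℕ → ℕ)), 𝒞.Countable ∧ 𝒞.PairwiseDisjoint id ∧
      (∀ s ∈ 𝒞, s ⊆ U ∧ ∃ (x : ℕ → ℕ) (n : ℕ), x n = 0 ∧ s = cylinder x (n + 1)) ∧
      ∀ x ∈ U, (∃ᶠ n in atTop, x n = 0) → x ∈ ⋃₀ 𝒞 := by
  -- Only the first zero-ended cylinder to fit inside `U` is kept; this minimality forces
  -- disjointness.
  set 𝒞 : Set (Set (ℕ → ℕ)) := {s | s ⊆ U ∧ ∃ (x : ℕ → ℕ) (n : ℕ), x n = 0 ∧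
    s = cylinder x (n + 1) ∧ ∀ m < n, x m = 0 → ¬ cylinder x (m + 1) ⊆ U} with h𝒞
  have key : ∀ s ∈ 𝒞, ∀ z ∈ s, ∃ n, z n = 0 ∧ s = cylinder z (n + 1) ∧
      ∀ m < n, z m = 0 → ¬ cylinder z (m + 1) ⊆ U := by
    rintro s ⟨hs, x, n, hx, rfl, hmin⟩ z hz
    have hcyl : ∀ m ≤ n, cylinder z (m + 1) = cylinder x (m + 1) := fun m hm =>
      mem_cylinder_iff_eq.1 (cylinder_anti x (by lia) hz)
    refine ⟨n, (hz n (by simp)).trans hx, (hcyl n le_rfl).symm, fun m hm h0 => ?_⟩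
    rw [hcyl m hm.le]
    exact hmin m hm ((hz m (by lia)).symm.trans h0)
  have hdisj : 𝒞.PairwiseDisjoint id := by
    intro s hs t ht hne
    rw [Function.onFun, Set.disjoint_left]
    intro z hzs hzt
    obtain ⟨n, hn0, hsn, hn⟩ := key s hs z hzs
    obtain ⟨m, hm0, htm, hm⟩ := key t ht z hzt
    rcases lt_trichotomy n m with h | h | h
    · exact hm n h hn0 (hsn ▸ hs.1)
    · exact hne (by rw [hsn, htm, h])
    · exact hn m h hm0 (htm ▸ ht.1)
  refine ⟨𝒞, ?_, hdisj, ?_, ?_⟩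
  · refine hdisj.countable_of_isOpen ?_ ?_
    · rintro s ⟨-, x, n, -, rfl, -⟩
      exact isOpen_cylinder _ x _
    · rintro s ⟨-, x, n, -, rfl, -⟩
      exact ⟨x, self_mem_cylinder x _⟩
  · rintro s ⟨hs, x, n, hx, rfl, -⟩
    exact ⟨hs, x, n, hx, rfl⟩
  · intro x hxU hfreq
    have hex : ∃ n, x n = 0 ∧ cylinder x (n + 1) ⊆ U := by
      obtain ⟨-, ⟨y, N, rfl⟩, hxN, hNU⟩ :=
        (isTopologicalBasis_cylinders (fun _ : ℕ => ℕ)).exists_subset_of_mem_open hxU hU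
      rw [← mem_cylinder_iff_eq.1 hxN] at hNU
      obtain ⟨n, hn, hn0⟩ := frequently_atTop.1 hfreq N
      exact ⟨n, hn0, (cylinder_anti x (by lia)).trans hNU⟩
    classical
    refine ⟨cylinder x (Nat.find hex + 1), ⟨(Nat.find_spec hex).2, x, Nat.find hex,
      (Nat.find_spec hex).1, rfl, fun m hm h0 h => Nat.find_min hex hm ⟨h0, h⟩⟩,
      self_mem_cylinder x _⟩

/-- A set that occupies a fixed proportion of every cylinder whose last digit is zero is null or
conull. -/
theorem measure_eq_zero_or_compl_of_cylinder {ν : Measure (ℕ → ℕ)} [IsFiniteMeasure ν]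
    (hzero : ∀ᵐ x ∂ν, ∃ᶠ n in atTop, x n = 0) {B : Set (ℕ → ℕ)} (hB : MeasurableSet B)
    {C : ℝ≥0∞} (hC : C ≠ ∞)
    (hcyl : ∀ (x : ℕ → ℕ) (n : ℕ), x n = 0 →
      ν (cylinder x (n + 1)) * ν B ≤ C * ν (cylinder x (n + 1) ∩ B)) :
    ν B = 0 ∨ ν Bᶜ = 0 := by
  have hopen : ∀ U, IsOpen U → ν U * ν B ≤ C * ν (U ∩ B) := by
    intro U hU
    obtain ⟨𝒞, hcount, hdisj, hsub, hcov⟩ := exists_disjoint_cylinders_of_isOpen hU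
    have hmeas : ∀ s ∈ 𝒞, MeasurableSet s := by
      intro s hs
      obtain ⟨-, x, n, -, rfl⟩ := hsub s hs
      exact (isOpen_cylinder _ x _).measurableSet
    have h1 : ν U ≤ ν (⋃₀ 𝒞) := measure_mono_ae (hzero.mono fun x hx hxU => hcov x hxU hx)
    have h2 : ν (⋃₀ 𝒞 ∩ B) ≤ ν (U ∩ B) :=
      measure_mono (inter_subset_inter_left _ (sUnion_subset fun s hs => (hsub s hs).1))
    have h3 : ν (⋃₀ 𝒞 ∩ B) = ∑' s : 𝒞, ν (s ∩ B) := by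
      rw [← Measure.restrict_apply (.sUnion hcount hmeas),
        measure_sUnion hcount hdisj hmeas]
      exact tsum_congr fun s => Measure.restrict_apply (hmeas s s.2)
    calc ν U * ν B ≤ ν (⋃₀ 𝒞) * ν B := by gcongr
      _ = ∑' s : 𝒞, ν s * ν B := by
        rw [measure_sUnion hcount hdisj hmeas, ENNReal.tsum_mul_right]
      _ ≤ ∑' s : 𝒞, C * ν (s ∩ B) := by
        refine ENNReal.tsum_le_tsum fun s => ?_
        obtain ⟨-, x, n, hx, hs⟩ := hsub s s.2
        rw [hs]
        exact hcyl x n hx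
      _ = C * ν (⋃₀ 𝒞 ∩ B) := by rw [ENNReal.tsum_mul_left, h3]
      _ ≤ C * ν (U ∩ B) := by gcongr
  -- By outer regularity, `Bᶜ` lies in an open `U` that meets `B` in measure at most `ε`; the bound
  -- for open sets then applies.
  have hprod : ν Bᶜ * ν B ≤ 0 := by
    refine ge_of_tendsto (f := fun ε : ℝ≥0∞ => C * ε) (x := 𝓝[>] 0) ?_ ?_
    · have := ENNReal.Tendsto.const_mul (a := C) (tendsto_id (α := ℝ≥0∞) (x := 𝓝 0)) (.inr hC)
      rw [mul_zero] at this
      exact this.mono_left nhdsWithin_le_nhds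
    · filter_upwards [self_mem_nhdsWithin] with ε hε
      obtain ⟨U, hBU, hUo, hU⟩ := Bᶜ.exists_isOpen_le_add ν (ne_of_gt hε)
      have h4 : ν (U ∩ B) ≤ ε := by
        have := measure_sdiff hBU hB.compl.nullMeasurableSet (measure_ne_top ν _)
        rw [sdiff_eq, compl_compl] at this
        rw [this]
        exact tsub_le_iff_left.2 hU
      calc ν Bᶜ * ν B ≤ ν U * ν B := by gcongr
        _ ≤ C * ν (U ∩ B) := hopen U hUo
        _ ≤ C * ε := by gcongr
  rcases mul_eq_zero.1 (le_zero_iff.1 hprod) with h | h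
  exacts [.inr h, .inl h]

end Symbolic

/-! ### Inverse branches and invariance of the measure -/

namespace TriangleMap

open Set

theorem measurableSet_triangle : MeasurableSet triangle :=
  (measurableSet_lt measurable_fst measurable_const).inter
    ((measurableSet_lt measurable_snd measurable_fst).inter
      (measurableSet_lt measurable_const measurable_snd))

theorem measurable_index : Measurable index :=
  Nat.measurable_floor.comp ((measurable_const.sub measurable_fst).div measurable_snd)

theorem measurable_map : Measurable map := by
  have h : Measurable fun p : ℝ × ℝ => (index p : ℝ) := measurable_from_nat.comp measurable_index
  exact (measurable_snd.div measurable_fst).prodMk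
    (((measurable_const.sub measurable_fst).sub (h.mul measurable_snd)).div measurable_fst)

theorem subtriangle_eq (k : ℕ) : subtriangle k = triangle ∩ index ⁻¹' {k} :=
  Set.ext fun _ => mem_subtriangle_iff

theorem measurableSet_subtriangle (k : ℕ) : MeasurableSet (subtriangle k) := by
  rw [subtriangle_eq]
  exact measurableSet_triangle.inter (measurable_index (measurableSet_singleton k))

theorem measurable_density : Measurable density := by
  unfold density
  fun_prop

/-- The inverse of the branch `T_k`. -/
noncomputable def invBranch (k : ℕ) (p : ℝ × ℝ) : ℝ × ℝ :=
  (1 / (1 + k * p.1 + p.2), p.1 / (1 + k * p.1 + p.2))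

theorem denom_pos {p : ℝ × ℝ} (hp : p ∈ triangle) (k : ℕ) : 0 < 1 + k * p.1 + p.2 := by
  obtain ⟨h1, h2, h3⟩ := hp
  have : 0 ≤ (k : ℝ) * p.1 := mul_nonneg k.cast_nonneg (by linarith)
  linarith

theorem branch_invBranch {p : ℝ × ℝ} (hp : p ∈ triangle) (k : ℕ) :
    branch k (invBranch k p) = p := by
  have h := denom_pos hp k
  ext
  · simp only [branch, invBranch]
    rw [div_div_div_cancel_right₀ h.ne', div_one]
  · simp only [branch, invBranch]
    field_simp
    ring

theorem invBranch_branch {p : ℝ × ℝ} (hp : p ∈ triangle) (k : ℕ) :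
    invBranch k (branch k p) = p := by
  obtain ⟨h1, h2, h3⟩ := hp
  have hx : p.1 ≠ 0 := by linarith
  have h : 1 + k * (p.2 / p.1) + (1 - p.1 - k * p.2) / p.1 = 1 / p.1 := by
    field_simp
    ring
  ext
  · simp only [branch, invBranch, h, one_div_one_div]
  · simp only [branch, invBranch, h]
    field_simp

theorem sub_invBranch {p : ℝ × ℝ} (hp : p ∈ triangle) (k : ℕ) :
    1 - (invBranch k p).1 - k * (invBranch k p).2 = p.2 / (1 + k * p.1 + p.2) := by
  have h := denom_pos hp k
  simp only [invBranch]
  field_simp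
  ring

theorem invBranch_mem {p : ℝ × ℝ} (hp : p ∈ triangle) (k : ℕ) :
    invBranch k p ∈ subtriangle k := by
  have h := denom_pos hp k
  have hs := sub_invBranch hp k
  obtain ⟨h1, h2, h3⟩ := hp
  have hx : 0 < p.1 := by linarith
  have hk : 0 ≤ (k : ℝ) * p.1 := mul_nonneg k.cast_nonneg hx.le
  refine ⟨⟨?_, ?_, ?_⟩, ?_, ?_⟩
  · simp only [invBranch, gt_iff_lt]
    rw [div_lt_one h]
    linarith
  · simp only [invBranch, gt_iff_lt]
    gcongr
  · simp only [invBranch, gt_iff_lt]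
    positivity
  · rw [hs]
    positivity
  · have : 1 - (invBranch k p).1 - (k + 1) * (invBranch k p).2 =
        (p.2 - p.1) / (1 + k * p.1 + p.2) := by
      rw [sub_div, ← hs]
      simp only [invBranch]
      ring
    rw [this]
    exact div_neg_of_neg_of_pos (by linarith) h

theorem map_invBranch {p : ℝ × ℝ} (hp : p ∈ triangle) (k : ℕ) : map (invBranch k p) = p := by
  rw [map_of_mem (invBranch_mem hp k), branch_invBranch hp k]

/-- The omitted edge is where `branch k` has second coordinate 0 and so leaves the open triangle. -/
theorem image_invBranch (k : ℕ) :
    invBranch k '' triangle = subtriangle k ∩ {p | 1 - p.1 - k * p.2 ≠ 0} := by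
  ext p
  constructor
  · rintro ⟨p, hp, rfl⟩
    refine ⟨invBranch_mem hp k, ?_⟩
    rw [mem_ofPred_eq, sub_invBranch hp k]
    exact (div_pos hp.2.2 (denom_pos hp k)).ne'
  · rintro ⟨⟨hp, h1, h2⟩, h3⟩
    refine ⟨branch k p, ?_, invBranch_branch hp k⟩
    obtain ⟨hp1, hp2, hp3⟩ := hp
    have hx : 0 < p.1 := by linarith
    refine ⟨?_, ?_, ?_⟩ <;> simp only [branch, gt_iff_lt]
    · rwa [div_lt_one hx]
    · gcongr
      linarith
    · exact div_pos (lt_of_le_of_ne h1 (Ne.symm h3)) hx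

theorem ae_sub_ne_zero (k : ℕ) : ∀ᵐ p : ℝ × ℝ, 1 - p.1 - k * p.2 ≠ 0 := by
  have hm : MeasurableSet {p : ℝ × ℝ | 1 - p.1 - k * p.2 = 0} :=
    measurableSet_eq_fun (by fun_prop) measurable_const
  rw [ae_iff, Measure.volume_eq_prod]
  simp only [not_not]
  rw [Measure.measure_prod_null hm]
  -- For `k = 0` the slice at `x = 1` is a whole line; all other slices have at most one point.
  have h1 : ∀ᵐ x : ℝ, x ≠ 1 := by simp [ae_iff]
  filter_upwards [h1] with x hx
  refine Set.Subsingleton.measure_zero (fun y hy z hz => ?_) _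
  simp only [mem_preimage, mem_ofPred_eq] at hy hz
  have : (k : ℝ) * (y - z) = 0 := by linarith
  rcases mul_eq_zero.1 this with h | h
  · rw [h] at hy
    exact absurd (by linarith) hx
  · linarith

theorem image_invBranch_ae_eq (k : ℕ) : invBranch k '' triangle =ᵐ[volume] subtriangle k := by
  rw [image_invBranch]
  filter_upwards [ae_sub_ne_zero k] with p hp
  exact propext (and_iff_left hp)

/-- The derivative of `invBranch k`. -/
noncomputable def fderivInvBranch (k : ℕ) (p : ℝ × ℝ) : ℝ × ℝ →L[ℝ] ℝ × ℝ :=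
  (Matrix.toLin (.finTwoProd ℝ) (.finTwoProd ℝ)
    !![-k / (1 + k * p.1 + p.2) ^ 2, -1 / (1 + k * p.1 + p.2) ^ 2;
      (1 + p.2) / (1 + k * p.1 + p.2) ^ 2, -p.1 / (1 + k * p.1 + p.2) ^ 2]).toContinuousLinearMap

theorem det_fderivInvBranch {p : ℝ × ℝ} (hp : p ∈ triangle) (k : ℕ) :
    (fderivInvBranch k p).det = ((1 + k * p.1 + p.2) ^ 3)⁻¹ := by
  have h := denom_pos hp k
  simp only [fderivInvBranch, LinearMap.det_toContinuousLinearMap, LinearMap.det_toLin,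
    Matrix.det_fin_two_of]
  field_simp
  ring

theorem hasFDerivAt_invBranch {p : ℝ × ℝ} (hp : p ∈ triangle) (k : ℕ) :
    HasFDerivAt (invBranch k) (fderivInvBranch k p) p := by
  have h := (denom_pos hp k).ne'
  have hD : HasFDerivAt (fun p : ℝ × ℝ => 1 + k * p.1 + p.2)
      ((k : ℝ) • ContinuousLinearMap.fst ℝ ℝ ℝ + ContinuousLinearMap.snd ℝ ℝ ℝ) p :=
    ((hasFDerivAt_fst.const_mul (k : ℝ)).const_add 1).add hasFDerivAt_snd
  have hI := (hasDerivAt_inv h).comp_hasFDerivAt p hD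
  have h2 := hI.prodMk (hasFDerivAt_fst.mul hI)
  have hfun : invBranch k = fun p : ℝ × ℝ => ((1 + k * p.1 + p.2)⁻¹,
      p.1 * (1 + k * p.1 + p.2)⁻¹) := by
    ext p <;> simp [invBranch, div_eq_mul_inv]
  rw [fderivInvBranch, Matrix.toLin_finTwoProd_toContinuousLinearMap, hfun]
  refine h2.congr_fderiv ?_
  ext <;> simp <;> field_simp
  ring

open scoped ENNReal

theorem lintegral_subtriangle (k : ℕ) (F : ℝ × ℝ → ℝ≥0∞) :
    ∫⁻ p in subtriangle k, F p =
      ∫⁻ p in triangle, ENNReal.ofReal ((1 + k * p.1 + p.2) ^ 3)⁻¹ * F (invBranch k p) := by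
  rw [← setLIntegral_congr (image_invBranch_ae_eq k),
    lintegral_image_eq_lintegral_abs_det_fderiv_mul volume measurableSet_triangle
      (fun p hp => (hasFDerivAt_invBranch hp k).hasFDerivWithinAt)
      (LeftInvOn.injOn fun p hp => branch_invBranch hp k)]
  refine setLIntegral_congr_fun measurableSet_triangle fun p hp => ?_
  have := denom_pos hp k
  rw [det_fderivInvBranch hp k, abs_of_pos (by positivity)]

theorem lintegral_triangle_eq_tsum (F : ℝ × ℝ → ℝ≥0∞) :
    ∫⁻ p in triangle, F p = ∑' k, ∫⁻ p in subtriangle k, F p := by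
  have hU : triangle = ⋃ k, subtriangle k := by
    ext p
    simp [mem_subtriangle_iff]
  rw [hU, lintegral_iUnion measurableSet_subtriangle]
  intro i j hij
  rw [Function.onFun, Set.disjoint_left]
  intro p hi hj
  exact hij ((mem_subtriangle_iff.1 hi).2.symm.trans (mem_subtriangle_iff.1 hj).2)

theorem density_pos {p : ℝ × ℝ} (hp : p ∈ triangle) : 0 < density p := by
  obtain ⟨h1, h2, h3⟩ := hp
  have : 0 < p.1 := by linarith
  have := Real.pi_pos
  unfold density
  positivity

/-- With `D = 1 + kx + y`, the term is `12 / (π² D (D + x))`, which splits as `12 / (π² x) * (1/D -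
1/(D + x))` and telescopes in `k`. -/
theorem hasSum_density_invBranch {p : ℝ × ℝ} (hp : p ∈ triangle) :
    HasSum (fun k : ℕ => ((1 + k * p.1 + p.2) ^ 3)⁻¹ * density (invBranch k p)) (density p) := by
  have hD := fun k => denom_pos hp k
  have hdp := fun k => density_pos (invBranch_mem hp k).1
  obtain ⟨h1, h2, h3⟩ := hp
  have hx : 0 < p.1 := by linarith
  have hpi := Real.pi_pos
  set u : ℕ → ℝ := fun k => 12 / (Real.pi ^ 2 * p.1) * (1 + k * p.1 + p.2)⁻¹ with hu
  have hterm : ∀ k : ℕ, ((1 + k * p.1 + p.2) ^ 3)⁻¹ * density (invBranch k p) =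
      u k - u (k + 1) := by
    intro k
    have h := hD k
    have h' := hD (k + 1)
    push_cast at h'
    have h'' : 0 < 1 + k * p.1 + p.2 + p.1 := by linarith
    have h4 : 1 + (k + 1 : ℝ) * p.1 + p.2 = 1 + k * p.1 + p.2 + p.1 := by ring
    simp only [hu, density, invBranch]
    push_cast
    rw [h4]
    generalize 1 + (k : ℝ) * p.1 + p.2 = D at *
    have h5 : 1 + p.1 / D = (D + p.1) / D := by field_simp
    rw [h5]
    field_simp
    ring
  rw [hasSum_iff_tendsto_nat_of_nonneg fun k =>
    mul_nonneg (inv_nonneg.2 (pow_nonneg (hD k).le 3)) (hdp k).le]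
  simp only [hterm, Finset.sum_range_sub']
  have h0 : u 0 = density p := by
    simp only [hu, density]
    field_simp
    simp
  have hlim : Tendsto (fun k : ℕ => 1 + k * p.1 + p.2) atTop atTop :=
    tendsto_atTop_add_const_right _ _ (tendsto_atTop_add_const_left _ _
      (tendsto_natCast_atTop_atTop.atTop_mul_const hx))
  have := (hlim.inv_tendsto_atTop.const_mul (12 / (Real.pi ^ 2 * p.1))).const_sub (u 0)
  simpa [h0] using this

theorem lintegral_invMeasure {F : ℝ × ℝ → ℝ≥0∞} (hF : Measurable F) :
    ∫⁻ p, F p ∂invMeasure = ∫⁻ p in triangle, ENNReal.ofReal (density p) * F p :=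
  lintegral_withDensity_eq_lintegral_mul _ measurable_density.ennreal_ofReal hF

/-- Changing variables on each `subtriangle k` turns invariance into the fixed-point equation
`hasSum_density_invBranch` of the transfer operator. -/
theorem measurePreserving_map : MeasurePreserving map invMeasure invMeasure := by
  refine ⟨measurable_map, Measure.ext fun s hs => ?_⟩
  have hd := measurable_density.ennreal_ofReal
  have hone : Measurable (s.indicator (1 : ℝ × ℝ → ℝ≥0∞)) := measurable_one.indicator hs
  rw [← lintegral_indicator_one hs, ← lintegral_indicator_one hs,
    lintegral_map hone measurable_map, lintegral_invMeasure (F := fun p => s.indicator 1 (map p)) (hone.comp measurable_map),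
    lintegral_invMeasure hone, lintegral_triangle_eq_tsum]
  simp only [lintegral_subtriangle]
  rw [← lintegral_tsum]
  · refine setLIntegral_congr_fun measurableSet_triangle fun p hp => ?_
    simp only [map_invBranch hp]
    have hsum := hasSum_density_invBranch hp
    rw [← hsum.tsum_eq, ENNReal.ofReal_tsum_of_nonneg _ hsum.summable, ← ENNReal.tsum_mul_right]
    · refine tsum_congr fun k => ?_
      have := denom_pos hp k
      rw [ENNReal.ofReal_mul (by positivity), mul_assoc]
    · intro k
      have := denom_pos hp k
      have := density_pos (invBranch_mem hp k).1
      positivity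
  · intro k
    have hinv : Measurable (invBranch k) := by
      unfold invBranch
      fun_prop
    have h1 : Measurable fun p : ℝ × ℝ => ((1 + k * p.1 + p.2) ^ 3)⁻¹ := by fun_prop
    exact (h1.ennreal_ofReal.mul ((hd.comp hinv).mul
      ((hone.comp measurable_map).comp hinv))).aemeasurable

end TriangleMap

/-! ### Total mass, and equivalence with Lebesgue measure -/

namespace TriangleMap

open Set
open scoped ENNReal

theorem lintegral_triangle {F : ℝ × ℝ → ℝ≥0∞} (hF : Measurable F) :
    ∫⁻ p in triangle, F p = ∫⁻ x in Ioo (0 : ℝ) 1, ∫⁻ y in Ioo 0 x, F (x, y) := by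
  rw [← lintegral_indicator measurableSet_triangle, Measure.volume_eq_prod,
    lintegral_prod _ (hF.indicator measurableSet_triangle).aemeasurable,
    ← lintegral_indicator measurableSet_Ioo]
  congr 1
  ext x
  by_cases hx : x ∈ Ioo (0 : ℝ) 1
  · rw [indicator_of_mem hx, ← lintegral_indicator measurableSet_Ioo]
    congr 1
    ext y
    refine indicator_eq_indicator ?_ rfl
    exact ⟨fun ⟨_, h2, h3⟩ => ⟨h3, h2⟩, fun ⟨h3, h2⟩ => ⟨hx.2, h2, h3⟩⟩
  · rw [indicator_of_notMem hx]
    refine lintegral_eq_zero_of_ae_eq_zero (ae_of_all _ fun y => indicator_of_notMem ?_ _)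
    exact fun ⟨h1, h2, h3⟩ => hx ⟨lt_trans h3 h2, h1⟩

theorem lintegral_Ioo_ofReal {f : ℝ → ℝ} (hf : Continuous f) {b : ℝ} (hb : 0 ≤ b)
    (h0 : ∀ y ∈ Ioo 0 b, 0 ≤ f y) :
    ∫⁻ y in Ioo 0 b, ENNReal.ofReal (f y) = ENNReal.ofReal (∫ y in 0..b, f y) := by
  rw [intervalIntegral.integral_of_le hb, integral_Ioc_eq_integral_Ioo,
    ofReal_integral_eq_lintegral_ofReal
      ((hf.integrableOn_Icc (a := 0) (b := b)).mono_set Ioo_subset_Icc_self)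
      ((ae_restrict_iff' measurableSet_Ioo).2 (ae_of_all _ h0))]

theorem lintegral_triangle_pow (k : ℕ) :
    ∫⁻ p in triangle, ENNReal.ofReal (p.2 ^ (2 * k) * (1 - p.2) / p.1) =
      ENNReal.ofReal (1 / (2 * k + 1) ^ 2 - 1 / (2 * k + 2) ^ 2) := by
  have hm : Measurable fun p : ℝ × ℝ => p.2 ^ (2 * k) * (1 - p.2) / p.1 := by fun_prop
  rw [lintegral_triangle hm.ennreal_ofReal]
  have hk1 : (2 * k + 1 : ℝ) ≠ 0 := by positivity
  have hk2 : (2 * k + 1 + 1 : ℝ) ≠ 0 := by positivity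
  have inner : ∀ x ∈ Ioo (0 : ℝ) 1,
      ∫⁻ y in Ioo 0 x, ENNReal.ofReal (y ^ (2 * k) * (1 - y) / x) =
        ENNReal.ofReal (x ^ (2 * k) / (2 * k + 1) - x ^ (2 * k + 1) / (2 * k + 2)) := by
    intro x hx
    have hx0 := hx.1
    rw [lintegral_Ioo_ofReal (f := fun y => y ^ (2 * k) * (1 - y) / x) (by fun_prop) hx.1.le
      fun y hy => ?_]
    · have h : ∀ y : ℝ, y ^ (2 * k) * (1 - y) = y ^ (2 * k) - y ^ (2 * k + 1) := fun y => by ring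
      simp only [h]
      rw [intervalIntegral.integral_div, intervalIntegral.integral_sub
        ((continuous_pow _).intervalIntegrable _ _) ((continuous_pow _).intervalIntegrable _ _),
        integral_pow, integral_pow]
      congr 1
      push_cast
      have h3 : (2 * k + 2 : ℝ) = 2 * k + 1 + 1 := by ring
      rw [h3]
      have h4 : (0 : ℝ) ^ (2 * k + 1) = 0 := zero_pow (by lia)
      have h5 : (0 : ℝ) ^ (2 * k + 1 + 1) = 0 := zero_pow (by lia)
      rw [h4, h5]
      field_simp
      ring
    · have h1 := hy.1
      have h2 := hy.2.trans hx.2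
      have h3 : 0 ≤ 1 - y := by linarith
      positivity
  rw [setLIntegral_congr_fun measurableSet_Ioo inner,
    lintegral_Ioo_ofReal (f := fun x => x ^ (2 * k) / (2 * k + 1) - x ^ (2 * k + 1) / (2 * k + 2))
      (by fun_prop) zero_le_one fun x hx => ?_]
  · rw [intervalIntegral.integral_sub
        (((continuous_pow _).div_const _).intervalIntegrable _ _)
        (((continuous_pow _).div_const _).intervalIntegrable _ _),
      intervalIntegral.integral_div, intervalIntegral.integral_div, integral_pow, integral_pow]
    congr 1
    have h3 : (2 * k + 2 : ℝ) = 2 * k + 1 + 1 := by ring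
    push_cast
    rw [h3]
    simp only [ne_eq, Nat.add_eq_zero_iff, one_ne_zero, and_false, not_false_eq_true, zero_pow,
        sub_zero, one_pow]
    field_simp
  · rw [sub_nonneg]
    have h1 := hx.1
    apply div_le_div₀ (by positivity) _ (by positivity) (by linarith)
    exact pow_le_pow_of_le_one hx.1.le hx.2.le (by lia)

/-- The even squares contribute a quarter of `π²/6`, namely `π²/24`, and the odd ones the remaining
`π²/8`. -/
theorem hasSum_sub_odd_even_sq :
    HasSum (fun k : ℕ => (1 / (2 * k + 1) ^ 2 - 1 / (2 * k + 2) ^ 2 : ℝ)) (Real.pi ^ 2 / 12) := by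
  set f : ℕ → ℝ := fun n => 1 / (n + 1) ^ 2 with hf
  have hall : HasSum f (Real.pi ^ 2 / 6) := by
    have := (hasSum_nat_add_iff' 1).2 hasSum_zeta_two
    simpa [hf] using this
  have hodd : HasSum (fun k => f (2 * k + 1)) (Real.pi ^ 2 / 24) := by
    have h1 : (fun k => f (2 * k + 1)) = fun k => f k / 4 := by
      ext k
      simp only [hf]
      push_cast
      field_simp
      ring
    have h2 : Real.pi ^ 2 / 24 = Real.pi ^ 2 / 6 / 4 := by ring
    rw [h1, h2]
    exact hall.div_const 4
  have heven : HasSum (fun k => f (2 * k)) (Real.pi ^ 2 / 8) := by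
    have hs : Summable fun k => f (2 * k) :=
      hall.summable.comp_injective (mul_right_injective₀ two_ne_zero)
    have := (hs.hasSum.even_add_odd hodd).unique hall
    have h2 : ∑' k, f (2 * k) = Real.pi ^ 2 / 8 := by linarith
    exact h2 ▸ hs.hasSum
  have h1 : (fun k : ℕ => (1 / (2 * k + 1) ^ 2 - 1 / (2 * k + 2) ^ 2 : ℝ)) =
      fun k => f (2 * k) - f (2 * k + 1) := by
    ext k
    simp only [hf]
    push_cast
    ring
  have h2 : Real.pi ^ 2 / 12 = Real.pi ^ 2 / 8 - Real.pi ^ 2 / 24 := by ring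
  rw [h1, h2]
  exact heven.sub hodd

/-- Writing `1/(1+y) = (1-y)/(1-y²)` gives a geometric series with nonnegative terms, so sum and
integral may be exchanged. -/
theorem hasSum_density {p : ℝ × ℝ} (hp : p ∈ triangle) :
    HasSum (fun k : ℕ => 12 / Real.pi ^ 2 * (p.2 ^ (2 * k) * (1 - p.2) / p.1)) (density p) := by
  obtain ⟨h1, h2, h3⟩ := hp
  have hx : 0 < p.1 := by linarith
  have h := hasSum_geometric_of_lt_one (sq_nonneg p.2) (by nlinarith : p.2 ^ 2 < 1)
  have h4 : density p = (1 - p.2 ^ 2)⁻¹ * (12 / Real.pi ^ 2 * ((1 - p.2) / p.1)) := by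
    have h5 : 1 - p.2 ≠ 0 := by linarith
    have h6 : 1 + p.2 ≠ 0 := by linarith
    have h7 : 1 - p.2 ^ 2 = (1 - p.2) * (1 + p.2) := by ring
    rw [h7, density]
    field_simp
  have h8 : (fun k : ℕ => 12 / Real.pi ^ 2 * (p.2 ^ (2 * k) * (1 - p.2) / p.1)) =
      fun k => (p.2 ^ 2) ^ k * (12 / Real.pi ^ 2 * ((1 - p.2) / p.1)) := by
    ext k
    rw [pow_mul]
    ring
  rw [h4, h8]
  exact h.mul_right _

instance isProbabilityMeasure_invMeasure : IsProbabilityMeasure invMeasure := by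
  refine ⟨?_⟩
  have hpi : 0 < 12 / Real.pi ^ 2 := by positivity
  have h1 : ∀ p ∈ triangle, ENNReal.ofReal (density p) =
      ∑' k : ℕ, ENNReal.ofReal (12 / Real.pi ^ 2) *
        ENNReal.ofReal (p.2 ^ (2 * k) * (1 - p.2) / p.1) := by
    intro p hp
    have hsum := hasSum_density hp
    obtain ⟨h1, h2, h3⟩ := hp
    have hx : 0 < p.1 := by linarith
    have hy : 0 ≤ 1 - p.2 := by linarith
    rw [← hsum.tsum_eq, ENNReal.ofReal_tsum_of_nonneg (fun k => by positivity) hsum.summable]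
    exact tsum_congr fun k => ENNReal.ofReal_mul hpi.le
  have hnn : ∀ k : ℕ, (0 : ℝ) ≤ 1 / (2 * k + 1) ^ 2 - 1 / (2 * k + 2) ^ 2 := by
    intro k
    rw [sub_nonneg]
    gcongr
    linarith
  have hm : ∀ k : ℕ, Measurable fun p : ℝ × ℝ => p.2 ^ (2 * k) * (1 - p.2) / p.1 := by
    intro k
    fun_prop
  have hsum := hasSum_sub_odd_even_sq
  rw [invMeasure, withDensity_apply _ .univ, Measure.restrict_univ,
    setLIntegral_congr_fun measurableSet_triangle h1,
    lintegral_tsum fun k => ((hm k).ennreal_ofReal.const_mul _).aemeasurable]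
  simp only [lintegral_const_mul _ (hm _).ennreal_ofReal, lintegral_triangle_pow]
  rw [ENNReal.tsum_mul_left, ← ENNReal.ofReal_tsum_of_nonneg hnn hsum.summable, hsum.tsum_eq,
    ← ENNReal.ofReal_mul hpi.le]
  have : 12 / Real.pi ^ 2 * (Real.pi ^ 2 / 12) = 1 := by
    field_simp
  rw [this, ENNReal.ofReal_one]

theorem invMeasure_real_subtriangle (k : ℕ) :
    invMeasure.real (subtriangle k) =
      ∫ p in subtriangle k, 12 / (Real.pi ^ 2 * p.1 * (1 + p.2)) := by
  have hsub : subtriangle k ⊆ triangle := fun p hp => hp.1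
  rw [Measure.real, invMeasure, withDensity_apply _ (measurableSet_subtriangle k),
    Measure.restrict_restrict (measurableSet_subtriangle k), inter_eq_left.2 hsub]
  refine (integral_eq_lintegral_of_nonneg_ae (f := density) ?_
    measurable_density.aestronglyMeasurable).symm
  exact (ae_restrict_iff' (measurableSet_subtriangle k)).2
    (ae_of_all _ fun p hp => (density_pos hp.1).le)

theorem invMeasure_absolutelyContinuous : invMeasure ≪ volume.restrict triangle :=
  withDensity_absolutelyContinuous _ _

theorem absolutelyContinuous_invMeasure : volume.restrict triangle ≪ invMeasure := by
  refine withDensity_absolutelyContinuous' measurable_density.ennreal_ofReal.aemeasurable ?_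
  refine (ae_restrict_iff' measurableSet_triangle).2 (ae_of_all _ fun p hp => ?_)
  simpa using density_pos hp

instance isFiniteMeasure_restrict_triangle : IsFiniteMeasure (volume.restrict triangle) := by
  refine ⟨?_⟩
  rw [Measure.restrict_apply_univ]
  refine (measure_mono (t := Icc 0 1 ×ˢ Icc 0 1) ?_).trans_lt
    (isCompact_Icc.prod isCompact_Icc).measure_lt_top
  rintro p ⟨h1, h2, h3⟩
  exact ⟨⟨by linarith, h1.le⟩, ⟨h3.le, by linarith⟩⟩

end TriangleMap

/-! ### Digit sequences and recurrence of the digit 0 -/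

namespace TriangleMap

open Set PiNat
open scoped ENNReal

/-- The sequence of indices along the orbit of a point. -/
noncomputable def digits (p : ℝ × ℝ) (n : ℕ) : ℕ := index (map^[n] p)

theorem measurable_digits : Measurable digits :=
  measurable_pi_lambda _ fun n => measurable_index.comp (measurable_map.iterate n)

/-- The left shift on sequences of natural numbers. -/
def shift (x : ℕ → ℕ) (n : ℕ) : ℕ := x (n + 1)

theorem measurable_shift : Measurable shift :=
  measurable_pi_lambda _ fun n => measurable_pi_apply (n + 1)

theorem digits_map (p : ℝ × ℝ) : digits (map p) = shift (digits p) := by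
  ext n
  rw [digits, shift, digits, Function.iterate_succ_apply]

theorem shift_iterate_apply (x : ℕ → ℕ) (i n : ℕ) : shift^[i] x n = x (n + i) := by
  induction i generalizing x with
  | zero => rfl
  | succ i ih =>
    rw [Function.iterate_succ_apply, ih, shift, Nat.add_assoc]

/-- The points of the triangle whose indices never vanish form a null set. -/
theorem invMeasure_forall_digits_ne_zero : invMeasure {p | ∀ n, digits p n ≠ 0} = 0 := by
  set B : Set (ℝ × ℝ) := {p | ∀ n, digits p n ≠ 0} with hB
  have hBm : MeasurableSet B := by
    have : B = ⋂ n, (fun p => digits p n) ⁻¹' {0}ᶜ := by ext; simp [hB]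
    rw [this]
    exact .iInter fun n => (measurable_pi_apply n).comp measurable_digits (.of_discrete)
  -- Both sets have the same finite measure, so their difference is null. It contains the part of
  -- `map ⁻¹' B` with first digit 0, which `invBranch 0` identifies with `B` up to a positive
  -- weight.
  have hsub : B ⊆ map ⁻¹' B := fun p hp n => by
    rw [digits_map]
    exact hp (n + 1)
  have hdiff : invMeasure (map ⁻¹' B \ B) = 0 := by
    rw [measure_sdiff hsub hBm.nullMeasurableSet (measure_ne_top _ _),
      measurePreserving_map.measure_preimage hBm.nullMeasurableSet, tsub_self]
  have hsub0 : subtriangle 0 ∩ map ⁻¹' B ⊆ map ⁻¹' B \ B := fun p hp =>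
    ⟨hp.2, fun h => h 0 (mem_subtriangle_iff.1 hp.1).2⟩
  have h0 : volume (subtriangle 0 ∩ map ⁻¹' B) = 0 := by
    have := absolutelyContinuous_invMeasure (measure_mono_null hsub0 hdiff)
    rwa [Measure.restrict_apply ((measurableSet_subtriangle 0).inter (measurable_map hBm)),
      inter_eq_left.2 (inter_subset_left.trans fun p hp => hp.1)] at this
  have h1 : ∫⁻ p in triangle, ENNReal.ofReal ((1 + ((0 : ℕ) : ℝ) * p.1 + p.2) ^ 3)⁻¹ *
      B.indicator 1 p = 0 := by
    have h2 := lintegral_subtriangle 0 ((map ⁻¹' B).indicator 1)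
    rw [lintegral_indicator_one (measurable_map hBm), Measure.restrict_apply (measurable_map hBm),
      inter_comm, h0] at h2
    rw [h2]
    refine setLIntegral_congr_fun measurableSet_triangle fun p hp => ?_
    have h3 : (map ⁻¹' B).indicator (1 : ℝ × ℝ → ℝ≥0∞) (invBranch 0 p) = B.indicator 1 p :=
      indicator_eq_indicator (by rw [mem_preimage, map_invBranch hp]) rfl
    simp only [h3]
  have hm : Measurable fun p : ℝ × ℝ => ((1 + ((0 : ℕ) : ℝ) * p.1 + p.2) ^ 3)⁻¹ := by fun_prop
  rw [lintegral_eq_zero_iff (f := fun p => _ * _) (hm.ennreal_ofReal.mul (measurable_one.indicator hBm))] at h1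
  refine invMeasure_absolutelyContinuous (measure_eq_zero_iff_ae_notMem.2 ?_)
  filter_upwards [h1, ae_restrict_mem measurableSet_triangle] with p hp hpt hpB
  have := denom_pos hpt 0
  simp only [Pi.zero_apply] at hp
  rw [indicator_of_mem hpB, Pi.one_apply, mul_one,
    ENNReal.ofReal_eq_zero] at hp
  exact hp.not_gt (by positivity)

theorem ae_frequently_digits_eq_zero : ∀ᵐ p ∂invMeasure, ∃ᶠ n in atTop, digits p n = 0 := by
  have h : ∀ᵐ p ∂invMeasure, ¬ ∀ n, digits p n ≠ 0 := by
    rw [ae_iff]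
    simpa using invMeasure_forall_digits_ne_zero
  have h' : ∀ᵐ p ∂invMeasure, ∀ N : ℕ, ¬ ∀ n, digits (map^[N] p) n ≠ 0 :=
    ae_all_iff.2 fun N => (measurePreserving_map.iterate N).quasiMeasurePreserving.ae h
  filter_upwards [h'] with p hp
  refine frequently_atTop.2 fun N => ?_
  have := hp N
  push Not at this
  obtain ⟨n, hn⟩ := this
  refine ⟨n + N, Nat.le_add_left _ _, ?_⟩
  rwa [digits, Function.iterate_add_apply]

/-! ### Bounded distortion -/

/-- The density `1 / (a + b x + c y)³` with respect to Lebesgue measure. -/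
noncomputable def cubeWeight (a b c : ℝ) (p : ℝ × ℝ) : ℝ := ((a + b * p.1 + c * p.2) ^ 3)⁻¹

/-- The transfer operator of the branch `T_k` maps `1 / (a + b x + c y)³` to a density of the same
form. -/
theorem lintegral_cubeWeight_indicator {a b c : ℝ} (ha : 0 < a) (hb : 0 ≤ b) (hc : 0 ≤ c) (k : ℕ)
    (G : ℝ × ℝ → ℝ≥0∞) :
    ∫⁻ p in triangle, ENNReal.ofReal (cubeWeight a b c p) *
        (index ⁻¹' {k}).indicator (fun z => G (map z)) p =
      ∫⁻ p in triangle, ENNReal.ofReal (cubeWeight (a + b) (k * a + c) a p) * G p := by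
  have h1 : ∀ p, ENNReal.ofReal (cubeWeight a b c p) *
        (index ⁻¹' {k}).indicator (fun z => G (map z)) p =
      (index ⁻¹' {k}).indicator
        (fun z => ENNReal.ofReal (cubeWeight a b c z) * G (map z)) p :=
    fun p => (indicator_mul_right _ (fun z => ENNReal.ofReal (cubeWeight a b c z)) _).symm
  simp only [h1]
  rw [setLIntegral_indicator (measurable_index (measurableSet_singleton k)), inter_comm,
    ← subtriangle_eq, lintegral_subtriangle]
  refine setLIntegral_congr_fun measurableSet_triangle fun p hp => ?_
  have hD := denom_pos hp k
  have hx : 0 < p.1 := hp.2.2.trans hp.2.1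
  have hpos : 0 < a + b * (1 / (1 + k * p.1 + p.2)) + c * (p.1 / (1 + k * p.1 + p.2)) := by
    positivity
  simp only [map_invBranch hp]
  rw [← mul_assoc, ← ENNReal.ofReal_mul (by positivity)]
  -- Multiplying `a + b/D + c x/D` by `D = 1 + kx + y` gives `(a + b) + (ka + c)x + ay`.
  congr 2
  simp only [cubeWeight, invBranch]
  rw [← mul_inv, ← mul_pow]
  congr 2
  field_simp
  ring

/-- Starting from `(1, 0, 0)`, each digit `k` replaces `(a, b, c)` by `(a + b, ka + c, a)`. This
preserves `c ≤ a`; when `k = 0` the new `b` is the old `c`, so `b ≤ a` as well. -/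
theorem exists_lintegral_cylinder (x : ℕ → ℕ) (n : ℕ) :
    ∃ a b c : ℝ, 0 < a ∧ 0 ≤ b ∧ 0 ≤ c ∧ c ≤ a ∧ (∀ m, n = m + 1 → x m = 0 → b ≤ a) ∧
      ∀ G : ℝ × ℝ → ℝ≥0∞,
        ∫⁻ p in triangle, (digits ⁻¹' cylinder x n).indicator (fun z => G (map^[n] z)) p =
          ∫⁻ p in triangle, ENNReal.ofReal (cubeWeight a b c p) * G p := by
  induction n with
  | zero => exact ⟨1, 0, 0, by simp [cubeWeight]⟩
  | succ n ih =>
    obtain ⟨a, b, c, ha, hb, hc, hca, -, h⟩ := ih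
    refine ⟨a + b, x n * a + c, a, by positivity, by positivity, ha.le, by linarith, ?_,
      fun G => ?_⟩
    · intro m hm h0
      obtain rfl : n = m := by lia
      rw [h0, Nat.cast_zero]
      linarith
    · rw [← lintegral_cubeWeight_indicator ha hb hc, ← h]
      congr 1
      ext p
      have hmem : p ∈ digits ⁻¹' cylinder x (n + 1) ↔
          p ∈ digits ⁻¹' cylinder x n ∧ map^[n] p ∈ index ⁻¹' {x n} := by
        simp only [mem_preimage, mem_cylinder_iff, Nat.lt_succ_iff_lt_or_eq, mem_singleton_iff]
        exact ⟨fun H => ⟨fun i hi => H i (.inl hi), H n (.inr rfl)⟩,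
          fun ⟨H1, H2⟩ i hi => hi.elim (H1 i) fun hi => hi ▸ H2⟩
      by_cases h1 : p ∈ digits ⁻¹' cylinder x n
      · rw [indicator_of_mem h1]
        by_cases h2 : map^[n] p ∈ index ⁻¹' {x n}
        · rw [indicator_of_mem h2, indicator_of_mem (hmem.2 ⟨h1, h2⟩),
            Function.iterate_succ_apply']
        · rw [indicator_of_notMem h2, indicator_of_notMem fun H => h2 (hmem.1 H).2]
      · rw [indicator_of_notMem h1, indicator_of_notMem fun H => h1 (hmem.1 H).1]

theorem measurableSet_digits_cylinder (x : ℕ → ℕ) (n : ℕ) :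
    MeasurableSet (digits ⁻¹' cylinder x n) :=
  measurable_digits (isOpen_cylinder _ x n).measurableSet

/-- Both coordinates lie in `(0, 1)`, so `a ≤ a + bx + cy ≤ 3a`; cubing gives 27. -/
theorem cubeWeight_bounds {a b c : ℝ} (ha : 0 < a) (hb : 0 ≤ b) (hc : 0 ≤ c) (hba : b ≤ a)
    (hca : c ≤ a) {p : ℝ × ℝ} (hp : p ∈ triangle) :
    cubeWeight a b c p ≤ (a ^ 3)⁻¹ ∧ (a ^ 3)⁻¹ ≤ 27 * cubeWeight a b c p := by
  obtain ⟨h1, h2, h3⟩ := hp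
  have hx : 0 < p.1 := by linarith
  have hlow : a ≤ a + b * p.1 + c * p.2 := by
    have := mul_nonneg hb hx.le
    have := mul_nonneg hc h3.le
    linarith
  have hupp : a + b * p.1 + c * p.2 ≤ 3 * a := by
    have := mul_le_mul hba h1.le hx.le ha.le
    have := mul_le_mul hca (h2.trans h1).le h3.le ha.le
    linarith
  have hpos : 0 < a + b * p.1 + c * p.2 := by linarith
  constructor
  · unfold cubeWeight
    gcongr
  · calc (a ^ 3)⁻¹ = 27 * ((3 * a) ^ 3)⁻¹ := by
          field_simp
          norm_num
      _ ≤ 27 * cubeWeight a b c p := by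
          unfold cubeWeight
          gcongr

/-- Bounded distortion on cylinders whose last digit is zero. -/
theorem measure_cylinder_mul_le (x : ℕ → ℕ) (n : ℕ) (hx : x n = 0) {E : Set (ℝ × ℝ)}
    (hE : MeasurableSet E) :
    volume.restrict triangle (digits ⁻¹' cylinder x (n + 1)) * volume.restrict triangle E ≤
      27 * volume.restrict triangle univ *
        volume.restrict triangle (digits ⁻¹' cylinder x (n + 1) ∩ map^[n + 1] ⁻¹' E) := by
  obtain ⟨a, b, c, ha, hb, hc, hca, hba, h⟩ := exists_lintegral_cylinder x (n + 1)
  have hbd := fun p hp => cubeWeight_bounds ha hb hc (hba n rfl hx) hca (p := p) hp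
  set C := digits ⁻¹' cylinder x (n + 1) with hCdef
  have hC : MeasurableSet C := measurableSet_digits_cylinder x (n + 1)
  have hTE : MeasurableSet (map^[n + 1] ⁻¹' E) := (measurable_map.iterate (n + 1)) hE
  -- `M` bounds the transferred density from above, and `M / 27` bounds it from below.
  set M : ℝ≥0∞ := ENNReal.ofReal (a ^ 3)⁻¹ with hM
  have h1 : volume.restrict triangle C ≤ M * volume.restrict triangle univ := by
    have := h 1
    simp only [Pi.one_apply, mul_one] at this
    rw [← lintegral_indicator_one hC]
    calc ∫⁻ p in triangle, C.indicator 1 p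
        = ∫⁻ p in triangle, ENNReal.ofReal (cubeWeight a b c p) := this
      _ ≤ ∫⁻ _ in triangle, M := setLIntegral_mono measurable_const fun p hp =>
          ENNReal.ofReal_le_ofReal (hbd p hp).1
      _ = M * volume.restrict triangle univ := lintegral_const _
  have h2 : M * volume.restrict triangle E ≤
      27 * volume.restrict triangle (C ∩ map^[n + 1] ⁻¹' E) := by
    have hCE : volume.restrict triangle (C ∩ map^[n + 1] ⁻¹' E) =
        ∫⁻ p in triangle, ENNReal.ofReal (cubeWeight a b c p) * E.indicator 1 p := by
      rw [← h, ← lintegral_indicator_one (hC.inter hTE)]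
      congr 1
      ext p
      by_cases hp : p ∈ C
      · rw [indicator_of_mem hp]
        exact indicator_eq_indicator (by simp [hp]) rfl
      · rw [indicator_of_notMem hp, indicator_of_notMem fun H => hp H.1]
    have hone : Measurable (E.indicator (1 : ℝ × ℝ → ℝ≥0∞)) := measurable_one.indicator hE
    have hw : Measurable fun p => ENNReal.ofReal (cubeWeight a b c p) * E.indicator 1 p := by
      have : Measurable (cubeWeight a b c) := by
        unfold cubeWeight
        fun_prop
      exact this.ennreal_ofReal.mul hone
    rw [hCE, ← lintegral_indicator_one hE, ← lintegral_const_mul _ hone,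
      ← lintegral_const_mul _ hw]
    refine setLIntegral_mono (hw.const_mul _) fun p hp => ?_
    rw [← mul_assoc]
    gcongr
    calc M ≤ ENNReal.ofReal (27 * cubeWeight a b c p) := ENNReal.ofReal_le_ofReal (hbd p hp).2
      _ = 27 * ENNReal.ofReal (cubeWeight a b c p) := by
        rw [ENNReal.ofReal_mul (by norm_num), ENNReal.ofReal_ofNat]
  calc _ ≤ M * volume.restrict triangle univ * volume.restrict triangle E := by gcongr
    _ = volume.restrict triangle univ * (M * volume.restrict triangle E) := by ring
    _ ≤ volume.restrict triangle univ *
        (27 * volume.restrict triangle (C ∩ map^[n + 1] ⁻¹' E)) := by gcongr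
    _ = _ := by ring

/-! ### Ergodicity of the shift and digit frequencies -/

theorem digits_comp_map : digits ∘ map = shift ∘ digits := funext digits_map

/-- Every shift-invariant set of digit sequences is null or conull. -/
theorem measure_digits_preimage_eq_zero_or_compl {B : Set (ℕ → ℕ)} (hB : MeasurableSet B)
    (hinv : shift ⁻¹' B = B) :
    volume.restrict triangle (digits ⁻¹' B) = 0 ∨
      volume.restrict triangle (digits ⁻¹' Bᶜ) = 0 := by
  set ν := (volume.restrict triangle).map digits with hν
  have happ : ∀ s, MeasurableSet s → ν s = volume.restrict triangle (digits ⁻¹' s) := fun s hs =>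
    Measure.map_apply measurable_digits hs
  have hmap : map ⁻¹' (digits ⁻¹' B) = digits ⁻¹' B := by
    rw [← preimage_comp, digits_comp_map, preimage_comp, hinv]
  have hiter : ∀ n, map^[n] ⁻¹' (digits ⁻¹' B) = digits ⁻¹' B := by
    intro n
    induction n with
    | zero => rfl
    | succ n ih => rw [Function.iterate_succ, preimage_comp, ih, hmap]
  have hzero : ∀ᵐ x ∂ν, ∃ᶠ n in atTop, x n = 0 := by
    have hm : MeasurableSet {x : ℕ → ℕ | ∃ᶠ n in atTop, x n = 0} := by
      have : {x : ℕ → ℕ | ∃ᶠ n in atTop, x n = 0} =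
          limsup (fun n => {x : ℕ → ℕ | x n = 0}) atTop := by
        ext x
        simp [mem_limsup_iff_frequently_mem]
      rw [this]
      exact .measurableSet_limsup fun n => measurable_pi_apply n (measurableSet_singleton 0)
    exact (ae_map_iff measurable_digits.aemeasurable hm).2
      (absolutelyContinuous_invMeasure.ae_le ae_frequently_digits_eq_zero)
  have := measure_eq_zero_or_compl_of_cylinder hzero hB
    (C := 27 * volume.restrict triangle univ)
    (ENNReal.mul_ne_top (by simp) (measure_ne_top _ _)) fun x n hx => by
      have hcyl : MeasurableSet (cylinder x (n + 1)) := (isOpen_cylinder _ x _).measurableSet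
      rw [happ _ hcyl, happ _ hB, happ _ (hcyl.inter hB), preimage_inter]
      have := measure_cylinder_mul_le x n hx (measurable_digits hB)
      rwa [hiter] at this
  rwa [happ _ hB, happ _ hB.compl] at this

/-- Invariance descends from `map` through `digits`; the zero-one law, proved for Lebesgue measure,
passes to `invMeasure` by absolute continuity. -/
theorem ergodic_shift : Ergodic shift (invMeasure.map digits) := by
  have hmp : MeasurePreserving shift (invMeasure.map digits) (invMeasure.map digits) := by
    refine ⟨measurable_shift, ?_⟩
    rw [Measure.map_map measurable_shift measurable_digits, ← digits_comp_map,
      ← Measure.map_map measurable_digits measurable_map, measurePreserving_map.map_eq]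
  refine ⟨hmp, ⟨fun B hB hinv => ?_⟩⟩
  rw [eventuallyConst_set']
  rcases measure_digits_preimage_eq_zero_or_compl hB hinv with h | h
  · left
    rw [ae_eq_empty, Measure.map_apply measurable_digits hB]
    exact invMeasure_absolutelyContinuous h
  · right
    rw [ae_eq_univ, Measure.map_apply measurable_digits hB.compl]
    exact invMeasure_absolutelyContinuous h

theorem ae_mem_triangle : ∀ᵐ p ∂invMeasure, p ∈ triangle :=
  invMeasure_absolutelyContinuous.ae_le (ae_restrict_mem measurableSet_triangle)

theorem ae_hasTriangleSequence_digits : ∀ᵐ p ∂invMeasure, HasTriangleSequence p (digits p) := by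
  have h : ∀ᵐ p ∂invMeasure, ∀ N : ℕ, map^[N] p ∈ triangle := ae_all_iff.2 fun N =>
    (measurePreserving_map.iterate N).quasiMeasurePreserving.ae ae_mem_triangle
  filter_upwards [h] with p hp N
  exact mem_subtriangle_iff.2 ⟨hp N, rfl⟩

theorem birkhoffAverage_shift_indicator (a : ℕ → ℕ) (k n : ℕ) :
    birkhoffAverage ℝ shift ({x : ℕ → ℕ | x 0 = k}.indicator 1) n a = proportion a k n := by
  rw [birkhoffAverage, birkhoffSum, proportion, Finset.card_filter, smul_eq_mul,
    inv_mul_eq_div, Nat.cast_sum]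
  congr 1
  refine Finset.sum_congr rfl fun i _ => ?_
  simp [indicator, shift_iterate_apply]

theorem ae_tendsto_proportion_digits (k : ℕ) :
    ∀ᵐ p ∂invMeasure, Tendsto (fun n : ℕ => proportion (digits p) k n) atTop
      (𝓝 (invMeasure.real (subtriangle k))) := by
  set S : Set (ℕ → ℕ) := {x | x 0 = k} with hS
  have hSm : MeasurableSet S :=
    measurable_pi_apply (X := fun _ : ℕ => ℕ) 0 (measurableSet_singleton k)
  have : IsProbabilityMeasure (invMeasure.map digits) :=
    Measure.isProbabilityMeasure_map measurable_digits.aemeasurable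
  have hg : Measurable (S.indicator (1 : (ℕ → ℕ) → ℝ)) := measurable_one.indicator hSm
  have hint : ∫ x, S.indicator (1 : (ℕ → ℕ) → ℝ) x ∂(invMeasure.map digits) =
      invMeasure.real (subtriangle k) := by
    rw [integral_indicator_one hSm, map_measureReal_apply measurable_digits hSm]
    refine measureReal_congr ?_
    filter_upwards [ae_mem_triangle] with p hp
    exact propext ⟨fun h => mem_subtriangle_iff.2 ⟨hp, h⟩, fun h => (mem_subtriangle_iff.1 h).2⟩
  have h := ergodic_shift.ae_tendsto_birkhoffAverage hg
    ((integrable_const (1 : ℝ)).indicator hSm)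
  filter_upwards [ae_of_ae_map measurable_digits.aemeasurable h] with p hp
  rw [hint] at hp
  simpa only [hS, birkhoffAverage_shift_indicator] using hp

end TriangleMap

theorem mainTheorem2 :
    IsProbabilityMeasure TriangleMap.invMeasure ∧
    MeasurePreserving TriangleMap.map TriangleMap.invMeasure TriangleMap.invMeasure ∧
    (∀ k : ℕ, TriangleMap.invMeasure.real (TriangleMap.subtriangle k) =
      ∫ p in TriangleMap.subtriangle k, 12 / (Real.pi ^ 2 * p.1 * (1 + p.2))) ∧
    ∀ᵐ p ∂(volume.restrict TriangleMap.triangle),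
      ∃ a : ℕ → ℕ, TriangleMap.HasTriangleSequence p a ∧
        ∀ k : ℕ, Tendsto (fun n : ℕ => TriangleMap.proportion a k n) atTop
          (𝓝 (TriangleMap.invMeasure.real (TriangleMap.subtriangle k))) := by
  refine ⟨inferInstance, TriangleMap.measurePreserving_map,
    TriangleMap.invMeasure_real_subtriangle, TriangleMap.absolutelyContinuous_invMeasure.ae_le ?_⟩
  filter_upwards [TriangleMap.ae_hasTriangleSequence_digits,
    ae_all_iff.2 TriangleMap.ae_tendsto_proportion_digits] with p hp hlim
  exact ⟨TriangleMap.digits p, hp, hlim⟩
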